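/- Let $\alpha\ge 1$ and let $u_0\in L^\infty(0,\infty)$ be nonnegative, with compact (that is, bounded essential) support in $[0,\infty)$ and mass $M=\|u_0\|_{L^1(0,\infty)}>0$. Put $m_0(\rho)=\int_0^\rho u_0(s)\,ds$ and let $m$ be the bounded and uniformly continuous viscosity solution on $[0,\infty)^2$ of $$m_t+(m_\rho)_+^{\alpha}\,m=0\quad(t,\rho>0),\qquad m(t,0)=0\quad (t>0),\qquad m(0,\rho)=m_0(\rho)\quad(\rho>0).$$ Here a continuous function $m$ on $[0,\infty)^2$ is a viscosity solution if it satisfies the boundary and initial conditions and if, for all $t,\rho>0$, one has $p_1+(p_2)_+^\alpha m(t,\rho)\le 0$ for every $(p_1,p_2)$ in the Fréchet superdifferential $D^+m(t,\rho)$ and $p_1+(p_2)_+^\alpha m(t,\rho)\ge 0$ for every $(p_1,p_2)$ in the Fréchet subdifferential $D^-m(t,\rho)$. For $t\ge 0$ let $S(t)=\inf\{\rho\ge 0: m(t,\rho)=M\}$. Then the set in this definition is nonempty for every $t\ge0$, and for every $t>0$ $$0\le \frac{S(t)}{M(\alpha t)^{1/\alpha}}-1\le \frac{S(0)}{M}(\alpha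 t)^{-1/\alpha};$$ in particular $S(t)\sim M(\alpha t)^{1/\alpha}$ as $t\to+\infty$. Furthermore, for every $\varepsilon>0$, $$\sup_{y\ge\varepsilon}\left|\frac{m\big(t,M(\alpha t)^{1/\alpha}y\big)}{M\,G(y)}-1\right|\to 0\quad\text{as } t\to+\infty,\qquad\text{where } G(y)=\begin{cases}y,& y\le 1,\\ 1,& y>1.\end{cases}$$ -/

import Mathlib

open Set Filter Topology MeasureTheory

noncomputable section

namespace MassHJ

/-- The closed quadrant `[0,∞)²` of points `(t, ρ)`: time and volume coordinate. -/
def quadrant : Set (ℝ × ℝ) := Ici 0 ×ˢ Ici 0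

/-- The action `p · v` of a slope `p = (p₁, p₂)` on a displacement `v = (v₁, v₂)`. -/
def slopeDot (p v : ℝ × ℝ) : ℝ := p.1 * v.1 + p.2 * v.2

/-- The Fréchet subdifferential `D⁻ f (x)` of a function on `Ω`: the slopes `p` with
`liminf_{y → x, y ∈ Ω} (f y - f x - p · (y - x)) / |y - x| ≥ 0`, written with `ε`.
(All norms of the plane give the same set.) -/
def frechetSub (Ω : Set (ℝ × ℝ)) (f : ℝ × ℝ → ℝ) (x : ℝ × ℝ) : Set (ℝ × ℝ) :=
  {p | ∀ ε > 0, ∀ᶠ y in 𝓝[Ω] x, -(ε * ‖y - x‖) ≤ f y - f x - slopeDot p (y - x)}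

/-- The Fréchet superdifferential `D⁺ f (x)` of a function on `Ω`: the slopes `p` with
`limsup_{y → x, y ∈ Ω} (f y - f x - p · (y - x)) / |y - x| ≤ 0`, written with `ε`. -/
def frechetSuper (Ω : Set (ℝ × ℝ)) (f : ℝ × ℝ → ℝ) (x : ℝ × ℝ) : Set (ℝ × ℝ) :=
  {p | ∀ ε > 0, ∀ᶠ y in 𝓝[Ω] x, f y - f x - slopeDot p (y - x) ≤ ε * ‖y - x‖}

/-- `m ∈ C([0,∞)²)` is a viscosity subsolution of the mass problem
`m_t + (m_ρ)₊^α m = 0` for `t, ρ > 0`, `m(t, 0) = 0` for `t > 0`,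
`m(0, ρ) = m₀(ρ)` for `ρ > 0`. -/
structure IsViscositySubsolution (α : ℝ) (m₀ : ℝ → ℝ) (m : ℝ × ℝ → ℝ) : Prop where
  continuousOn : ContinuousOn m quadrant
  equation : ∀ t > 0, ∀ ρ > 0, ∀ p ∈ frechetSuper quadrant m (t, ρ),
    p.1 + (max p.2 0) ^ α * m (t, ρ) ≤ 0
  initial : ∀ ρ > 0, m (0, ρ) ≤ m₀ ρ
  boundary : ∀ t > 0, m (t, 0) ≤ 0

/-- `m ∈ C([0,∞)²)` is a viscosity supersolution of the same mass problem. -/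
structure IsViscositySupersolution (α : ℝ) (m₀ : ℝ → ℝ) (m : ℝ × ℝ → ℝ) : Prop where
  continuousOn : ContinuousOn m quadrant
  equation : ∀ t > 0, ∀ ρ > 0, ∀ p ∈ frechetSub quadrant m (t, ρ),
    0 ≤ p.1 + (max p.2 0) ^ α * m (t, ρ)
  initial : ∀ ρ > 0, m₀ ρ ≤ m (0, ρ)
  boundary : ∀ t > 0, 0 ≤ m (t, 0)

/-- A viscosity solution is both a subsolution and a supersolution. -/
def IsViscositySolution (α : ℝ) (m₀ : ℝ → ℝ) (m : ℝ × ℝ → ℝ) : Prop :=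
  IsViscositySubsolution α m₀ m ∧ IsViscositySupersolution α m₀ m

/-- Bounded and uniformly continuous functions on `[0,∞)²`, the class in which the
viscosity solution is unique. -/
def IsBUC (m : ℝ × ℝ → ℝ) : Prop :=
  UniformContinuousOn m quadrant ∧ ∃ C, ∀ x ∈ quadrant, |m x| ≤ C

/-- The initial mass function `m₀(ρ) = ∫₀^ρ u₀` of a density in the volume coordinate. -/
def initialMass (u₀ : ℝ → ℝ) (ρ : ℝ) : ℝ := ∫ s in (0 : ℝ)..ρ, u₀ s

/-- The points `ρ ∈ [0,∞)` at which `m(t, ·)` attains the total mass `M`. -/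
def fullMassSet (M : ℝ) (m : ℝ × ℝ → ℝ) (t : ℝ) : Set ℝ := {ρ | 0 ≤ ρ ∧ m (t, ρ) = M}

/-- The edge of the support, `S(t) = inf {ρ : m(t, ρ) = M}`. -/
def supportEdge (M : ℝ) (m : ℝ × ℝ → ℝ) (t : ℝ) : ℝ := sInf (fullMassSet M m t)

/-- The vortex profile: `G(y) = y` for `y ≤ 1` and `G(y) = 1` for `y > 1`. -/
def vortexProfile (y : ℝ) : ℝ := if y ≤ 1 then y else 1

end MassHJ

end

/-!
The vortex of mass `M` is the explicit solution `min (ρ κ(t)) M` with `κ(t) = (αt)^{-1/α}`, whose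
density `κ` solves `κ' = -κ^α κ`. The whole theorem follows from the two-sided bound
`min ((ρ - S(0)) κ(t)) M ≤ m(t, ρ) ≤ min (ρ κ(t)) M` of `IsViscositySolution.between_vortices`:
it confines the edge `S(t)` to `[M / κ(t), S(0) + M / κ(t)]`, and in the rescaled volume
`y = ρ κ(t) / M` it traps `m` between `M G(y) - S(0) κ(t)` and `M G(y)`, where `κ(t) → 0`.

Each bound is a comparison of `m` with a barrier that is differentiable where it matters, so the
doubling of variables is not needed: if `m` minus the barrier, penalised by `δ (t + ρ)`, had a
positive maximum, it would be interior, and the slope of the penalised barrier would lie in `D⁺ m`,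
against the equation (`IsViscositySubsolution.le_barrier`, and `IsViscositySupersolution.barrier_le`
for bounds from below).

For the upper bound, the barrier is `ρ κ(t + τ)`, smooth for `t ≥ 0`; it lies above `m` at time
zero once `κ(τ)` exceeds the essential supremum of `u₀`, and `κ(t + τ) ≤ κ(t)`. The constant `M` is
a second barrier. For the lower bound, the minimum with `M` has a concave kink, at which a test from
below is impossible; it is replaced by `Φ((ρ - S(0)) κ(t + τ))` with `Φ` a smooth approximation of
`z ↦ min z M` from below satisfying `0 ≤ Φ' ≤ 1`. Where `Φ' > 0`, this is a classical subsolution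
precisely when `Φ'^{α-1} Φ(z) ≤ z`, which is needed only where `Φ(z) > 0`, and that is
where `α ≥ 1` enters. At time zero it is at most `m₀`, because `m₀ = M` beyond `S(0)`; the smoothing
and `τ` are then sent to zero.
-/

namespace MassHJ

/-! ### Test functions for the semidifferentials -/

/-- The linear functional `v ↦ p · v` on the plane. -/
def slopeCLM (p : ℝ × ℝ) : ℝ × ℝ →L[ℝ] ℝ :=
  p.1 • ContinuousLinearMap.fst ℝ ℝ ℝ + p.2 • ContinuousLinearMap.snd ℝ ℝ ℝ

lemma slopeCLM_apply (p v : ℝ × ℝ) : slopeCLM p v = slopeDot p v := by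
  simp [slopeCLM, slopeDot]

lemma hasFDerivAt_penalty (δ : ℝ) (x : ℝ × ℝ) :
    HasFDerivAt (fun y : ℝ × ℝ => δ * (y.1 + y.2)) (slopeCLM (δ, δ)) x := by
  refine ((hasFDerivAt_fst.add hasFDerivAt_snd).const_mul δ).congr_fderiv ?_
  ext <;> simp [slopeCLM]

lemma slopeCLM_add (p q : ℝ × ℝ) : slopeCLM (p + q) = slopeCLM p + slopeCLM q := by
  ext <;> simp [slopeCLM]

lemma slopeCLM_sub (p q : ℝ × ℝ) : slopeCLM (p - q) = slopeCLM p - slopeCLM q := by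
  ext <;> simp [slopeCLM]

/-- The slope of a differentiable function touching `f` from above lies in `D⁺ f`. -/
lemma mem_frechetSuper_of_isMaxOn {Ω : Set (ℝ × ℝ)} {f φ : ℝ × ℝ → ℝ} {x p : ℝ × ℝ}
    (hφ : HasFDerivAt φ (slopeCLM p) x) (hmax : IsMaxOn (fun y => f y - φ y) Ω x) :
    p ∈ frechetSuper Ω f x := by
  intro ε hε
  filter_upwards [nhdsWithin_le_nhds (hφ.isLittleO.def hε), self_mem_nhdsWithin] with y hy hyΩ
  have h1 : f y - φ y ≤ f x - φ x := hmax hyΩ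
  rw [slopeCLM_apply, Real.norm_eq_abs] at hy
  linarith [le_abs_self (φ y - φ x - slopeDot p (y - x))]

/-- The slope of a differentiable function touching `f` from below lies in `D⁻ f`. -/
lemma mem_frechetSub_of_isMinOn {Ω : Set (ℝ × ℝ)} {f φ : ℝ × ℝ → ℝ} {x p : ℝ × ℝ}
    (hφ : HasFDerivAt φ (slopeCLM p) x) (hmin : IsMinOn (fun y => f y - φ y) Ω x) :
    p ∈ frechetSub Ω f x := by
  intro ε hε
  filter_upwards [nhdsWithin_le_nhds (hφ.isLittleO.def hε), self_mem_nhdsWithin] with y hy hyΩ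
  have h1 : f x - φ x ≤ f y - φ y := hmin hyΩ
  rw [slopeCLM_apply, Real.norm_eq_abs] at hy
  linarith [neg_abs_le (φ y - φ x - slopeDot p (y - x))]

/-! ### Comparison with differentiable barriers -/

/-- A continuous function on the quadrant that is nonpositive on the two axes, tends to `-∞` at
infinity and is positive somewhere attains its maximum at an interior point. -/
lemma exists_interior_isMaxOn {f : ℝ × ℝ → ℝ} (hf : ContinuousOn f quadrant) {C δ : ℝ}
    (hδ : 0 < δ) (hC : ∀ x ∈ quadrant, f x ≤ C - δ * (x.1 + x.2))
    (hinit : ∀ ρ, 0 ≤ ρ → f (0, ρ) ≤ 0) (hbdry : ∀ t, 0 ≤ t → f (t, 0) ≤ 0)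
    {x₀ : ℝ × ℝ} (hx₀ : x₀ ∈ quadrant) (hpos : 0 < f x₀) :
    ∃ t > 0, ∃ ρ > 0, 0 < f (t, ρ) ∧ IsMaxOn f quadrant (t, ρ) := by
  set K : Set (ℝ × ℝ) := Icc 0 (C / δ) ×ˢ Icc 0 (C / δ) with hK
  have hKq : K ⊆ quadrant := prod_mono Icc_subset_Ici_self Icc_subset_Ici_self
  have hout : ∀ x ∈ quadrant, 0 < f x → x ∈ K := by
    intro x hx hfx
    have h1 : (0 : ℝ) ≤ x.1 := hx.1
    have h2 : (0 : ℝ) ≤ x.2 := hx.2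
    have h3 : x.1 + x.2 ≤ C / δ := by
      rw [le_div_iff₀ hδ]
      linarith [hC x hx]
    exact ⟨⟨h1, by linarith⟩, ⟨h2, by linarith⟩⟩
  obtain ⟨x, hxK, hx⟩ := (isCompact_Icc.prod isCompact_Icc : IsCompact K).exists_isMaxOn
    ⟨x₀, hout x₀ hx₀ hpos⟩ (hf.mono hKq)
  have hfx : 0 < f x := hpos.trans_le (hx (hout x₀ hx₀ hpos))
  obtain ⟨t, ρ⟩ := x
  have ht : (0 : ℝ) ≤ t := hxK.1.1
  have hρ : (0 : ℝ) ≤ ρ := hxK.2.1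
  refine ⟨t, lt_of_le_of_ne ht ?_, ρ, lt_of_le_of_ne hρ ?_, hfx, ?_⟩
  · rintro rfl
    exact hfx.not_ge (hinit ρ hρ)
  · rintro rfl
    exact hfx.not_ge (hbdry t ht)
  · intro y hy
    rcases le_or_gt (f y) 0 with h | h
    · exact h.trans hfx.le
    · exact hx (hout y hy h)

/-- The boundary condition at `ρ = 0` extends to the corner by continuity. -/
lemma boundary_nonpos {α : ℝ} {m₀ : ℝ → ℝ} {m : ℝ × ℝ → ℝ}
    (hm : IsViscositySubsolution α m₀ m) {t : ℝ} (ht : 0 ≤ t) : m (t, 0) ≤ 0 := by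
  have hc : ContinuousOn (fun s : ℝ => m (s, 0)) (Ici 0) :=
    hm.continuousOn.comp (by fun_prop) fun s hs => ⟨hs, self_mem_Ici⟩
  have h := (hc t ht).mono Ioi_subset_Ici_self
  have : t ∈ closure (Ioi (0 : ℝ)) := by rwa [closure_Ioi]
  have := mem_closure_iff_nhdsWithin_neBot.1 this
  exact le_of_tendsto h (eventually_mem_nhdsWithin.mono fun s hs => hm.boundary s hs)

lemma boundary_nonneg {α : ℝ} {m₀ : ℝ → ℝ} {m : ℝ × ℝ → ℝ}
    (hm : IsViscositySupersolution α m₀ m) {t : ℝ} (ht : 0 ≤ t) : 0 ≤ m (t, 0) := by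
  have hc : ContinuousOn (fun s : ℝ => m (s, 0)) (Ici 0) :=
    hm.continuousOn.comp (by fun_prop) fun s hs => ⟨hs, self_mem_Ici⟩
  have h := (hc t ht).mono Ioi_subset_Ici_self
  have : t ∈ closure (Ioi (0 : ℝ)) := by rwa [closure_Ioi]
  have := mem_closure_iff_nhdsWithin_neBot.1 this
  exact ge_of_tendsto h (eventually_mem_nhdsWithin.mono fun s hs => hm.boundary s hs)

lemma tendsto_penalty (a c : ℝ) :
    Tendsto (fun δ : ℝ => a + δ * c) (𝓝[>] 0) (𝓝 a) := by
  have : Tendsto (fun δ : ℝ => a + δ * c) (𝓝 0) (𝓝 (a + 0 * c)) :=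
    (by fun_prop : Continuous fun δ : ℝ => a + δ * c).tendsto 0
  simpa using this.mono_left nhdsWithin_le_nhds

/-- Comparison of a bounded viscosity subsolution with a barrier from above that is differentiable
where it matters. The penalty `δ (t + ρ)` serves to localise the maximum of the difference and to
make the barrier strict; since it raises the slope `p₂`, the inequality for the barrier
is required for all larger slopes. -/
lemma IsViscositySubsolution.le_barrier {α : ℝ} {m₀ : ℝ → ℝ} {m ψ : ℝ × ℝ → ℝ}
    (hm : IsViscositySubsolution α m₀ m) {C : ℝ} (hC : ∀ x ∈ quadrant, m x ≤ C)
    (hψc : ContinuousOn ψ quadrant) (hψ0 : ∀ x ∈ quadrant, 0 ≤ ψ x)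
    (hinit : ∀ ρ, 0 < ρ → m₀ ρ ≤ ψ (0, ρ))
    (hψ : ∀ t > 0, ∀ ρ > 0, ψ (t, ρ) < m (t, ρ) → ∃ p, HasFDerivAt ψ (slopeCLM p) (t, ρ) ∧
      ∀ q ≥ p.2, 0 ≤ p.1 + (max q 0) ^ α * m (t, ρ))
    {x : ℝ × ℝ} (hx : x ∈ quadrant) : m x ≤ ψ x := by
  have key : ∀ δ > 0, m x ≤ ψ x + δ * (x.1 + x.2) := by
    intro δ hδ
    by_contra! hcon
    have hbdry : ∀ t, 0 ≤ t → m (t, 0) ≤ ψ (t, 0) := fun t ht =>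
      (boundary_nonpos hm ht).trans (hψ0 _ ⟨ht, self_mem_Ici⟩)
    obtain ⟨t, ht, ρ, hρ, hpos, hmax⟩ := exists_interior_isMaxOn
      (f := fun y => m y - (ψ y + δ * (y.1 + y.2))) (C := C) (δ := δ)
      (hm.continuousOn.sub (hψc.add (by fun_prop))) hδ
      (fun y hy => by linarith [hC y hy, hψ0 y hy])
      (fun ρ hρ => by
        rcases hρ.eq_or_lt with rfl | hρ'
        · simpa using hbdry 0 le_rfl
        · have h1 := hm.initial ρ hρ'
          have h2 := hinit ρ hρ'
          have h3 : 0 ≤ δ * (0 + ρ) := by positivity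
          dsimp only
          linarith)
      (fun t ht => by
        have h1 := hbdry t ht
        have h3 : 0 ≤ δ * (t + 0) := by positivity
        dsimp only
        linarith) hx (by linarith)
    dsimp only at hpos
    have h3 : 0 < δ * (t + ρ) := by positivity
    obtain ⟨p, hp, hq⟩ := hψ t ht ρ hρ (by linarith)
    have hd : HasFDerivAt (fun y : ℝ × ℝ => ψ y + δ * (y.1 + y.2))
        (slopeCLM (p + (δ, δ))) (t, ρ) := by
      rw [slopeCLM_add]
      exact hp.add (hasFDerivAt_penalty δ _)
    have h4 := hm.equation t ht ρ hρ _ (mem_frechetSuper_of_isMaxOn hd hmax)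
    have h5 := hq (p.2 + δ) (by linarith)
    simp only [Prod.fst_add, Prod.snd_add] at h4
    linarith
  exact ge_of_tendsto (tendsto_penalty _ _) (eventually_mem_nhdsWithin.mono fun δ hδ => key δ hδ)

/-- Comparison of a viscosity supersolution bounded below with a barrier from below that is
differentiable where it matters. -/
lemma IsViscositySupersolution.barrier_le {α : ℝ} {m₀ : ℝ → ℝ} {m ψ : ℝ × ℝ → ℝ}
    (hm : IsViscositySupersolution α m₀ m) {C : ℝ} (hC : ∀ x ∈ quadrant, -C ≤ m x)
    (hψc : ContinuousOn ψ quadrant) {K : ℝ} (hψK : ∀ x ∈ quadrant, ψ x ≤ K)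
    (hinit : ∀ ρ, 0 < ρ → ψ (0, ρ) ≤ m₀ ρ) (hψ0 : ∀ t, 0 ≤ t → ψ (t, 0) ≤ 0)
    (hψ : ∀ t > 0, ∀ ρ > 0, m (t, ρ) < ψ (t, ρ) → ∃ p, HasFDerivAt ψ (slopeCLM p) (t, ρ) ∧
      ∀ q ≤ p.2, p.1 + (max q 0) ^ α * m (t, ρ) ≤ 0)
    {x : ℝ × ℝ} (hx : x ∈ quadrant) : ψ x ≤ m x := by
  have key : ∀ δ > 0, ψ x ≤ m x + δ * (x.1 + x.2) := by
    intro δ hδ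
    by_contra! hcon
    have hbdry : ∀ t, 0 ≤ t → ψ (t, 0) ≤ m (t, 0) := fun t ht =>
      (hψ0 t ht).trans (boundary_nonneg hm ht)
    obtain ⟨t, ht, ρ, hρ, hpos, hmax⟩ := exists_interior_isMaxOn
      (f := fun y => ψ y - δ * (y.1 + y.2) - m y) (C := K + C) (δ := δ)
      ((hψc.sub (by fun_prop)).sub hm.continuousOn) hδ
      (fun y hy => by linarith [hC y hy, hψK y hy])
      (fun ρ hρ => by
        rcases hρ.eq_or_lt with rfl | hρ'
        · simpa using hbdry 0 le_rfl
        · have h1 := hm.initial ρ hρ'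
          have h2 := hinit ρ hρ'
          have h3 : 0 ≤ δ * (0 + ρ) := by positivity
          dsimp only
          linarith)
      (fun t ht => by
        have h1 := hbdry t ht
        have h3 : 0 ≤ δ * (t + 0) := by positivity
        dsimp only
        linarith) hx (by linarith)
    dsimp only at hpos
    have h3 : 0 < δ * (t + ρ) := by positivity
    obtain ⟨p, hp, hq⟩ := hψ t ht ρ hρ (by linarith)
    have hd : HasFDerivAt (fun y : ℝ × ℝ => ψ y - δ * (y.1 + y.2))
        (slopeCLM (p - (δ, δ))) (t, ρ) := by
      rw [slopeCLM_sub]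
      exact hp.sub (hasFDerivAt_penalty δ _)
    have hmin : IsMinOn (fun y => m y - (ψ y - δ * (y.1 + y.2))) quadrant (t, ρ) := by
      simpa using hmax.neg
    have h4 := hm.equation t ht ρ hρ _ (mem_frechetSub_of_isMinOn hd hmin)
    have h5 := hq (p.2 - δ) (by linarith)
    simp only [Prod.fst_sub, Prod.snd_sub] at h4
    linarith
  exact ge_of_tendsto (tendsto_penalty _ _) (eventually_mem_nhdsWithin.mono fun δ hδ => key δ hδ)

lemma IsViscositySubsolution.le_const {α : ℝ} {m₀ : ℝ → ℝ} {m : ℝ × ℝ → ℝ}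
    (hm : IsViscositySubsolution α m₀ m) {C : ℝ} (hC : ∀ x ∈ quadrant, m x ≤ C) {M : ℝ}
    (hM : 0 ≤ M) (hinit : ∀ ρ, 0 < ρ → m₀ ρ ≤ M) {x : ℝ × ℝ} (hx : x ∈ quadrant) : m x ≤ M := by
  refine hm.le_barrier (ψ := fun _ => M) hC continuousOn_const (fun _ _ => hM) hinit
    (fun t _ ρ _ hlt => ⟨0, ?_, fun q _ => ?_⟩) hx
  · refine (hasFDerivAt_const M _).congr_fderiv ?_
    ext <;> simp [slopeCLM]
  · have : 0 ≤ m (t, ρ) := hM.trans hlt.le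
    simp only [Prod.fst_zero, zero_add]
    positivity

lemma IsViscositySupersolution.nonneg {α : ℝ} (hα : α ≠ 0) {m₀ : ℝ → ℝ} {m : ℝ × ℝ → ℝ}
    (hm : IsViscositySupersolution α m₀ m) {C : ℝ} (hC : ∀ x ∈ quadrant, -C ≤ m x)
    (hinit : ∀ ρ, 0 < ρ → 0 ≤ m₀ ρ) {x : ℝ × ℝ} (hx : x ∈ quadrant) : 0 ≤ m x := by
  refine hm.barrier_le (ψ := fun _ => 0) hC continuousOn_const (K := 0) (fun _ _ => le_rfl) hinit
    (fun _ _ => le_rfl) (fun t _ ρ _ hlt => ⟨0, ?_, fun q hq => ?_⟩) hx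
  · refine (hasFDerivAt_const (0 : ℝ) _).congr_fderiv ?_
    ext <;> simp [slopeCLM]
  · have : max q 0 = 0 := max_eq_right (by simpa using hq)
    simp [this, Real.zero_rpow hα]

/-! ### The vortex as a barrier -/

/-- The density `(αt)^{-1/α}` of the vortex solution at time `t`. -/
noncomputable def vortexDensity (α t : ℝ) : ℝ := (α * t) ^ (-(1 / α))

lemma vortexDensity_pos {α t : ℝ} (hα : 0 < α) (ht : 0 < t) : 0 < vortexDensity α t :=
  Real.rpow_pos_of_pos (mul_pos hα ht) _

lemma vortexDensity_mul_radius {α t : ℝ} (hα : 0 < α) (ht : 0 < t) :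
    (α * t) ^ (1 / α) * vortexDensity α t = 1 := by
  rw [vortexDensity, ← Real.rpow_add (mul_pos hα ht), add_neg_cancel, Real.rpow_zero]

lemma vortexDensity_anti {α s t : ℝ} (hα : 0 < α) (hs : 0 < s) (hst : s ≤ t) :
    vortexDensity α t ≤ vortexDensity α s :=
  Real.rpow_le_rpow_of_nonpos (mul_pos hα hs) (by gcongr)
    (neg_nonpos.2 (by positivity))

/-- The density `κ` of the vortex solves the ordinary differential equation `κ' = -κ^α κ`. -/
lemma hasDerivAt_vortexDensity {α t : ℝ} (hα : 0 < α) (ht : 0 < t) :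
    HasDerivAt (vortexDensity α) (-(vortexDensity α t ^ α * vortexDensity α t)) t := by
  have hpos : 0 < α * t := mul_pos hα ht
  have h := ((hasDerivAt_id t).const_mul α).rpow_const (p := -(1 / α)) (Or.inl hpos.ne')
  refine h.congr_deriv ?_
  have h1 : vortexDensity α t ^ α = (α * t) ^ (-1 : ℝ) := by
    rw [vortexDensity, ← Real.rpow_mul hpos.le]
    congr 1
    field_simp
  rw [h1, vortexDensity, ← Real.rpow_add hpos]
  have h2 : -(1 / α) - 1 = -1 + -(1 / α) := by ring
  simp only [id, mul_one]
  rw [h2]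
  field_simp

lemma continuousOn_vortexDensity {α : ℝ} (hα : 0 < α) : ContinuousOn (vortexDensity α) (Ioi 0) :=
  fun _ ht => (hasDerivAt_vortexDensity hα ht).continuousAt.continuousWithinAt

lemma continuousOn_scaled {α a τ : ℝ} (hα : 0 < α) (hτ : 0 < τ) :
    ContinuousOn (fun y : ℝ × ℝ => (y.2 - a) * vortexDensity α (y.1 + τ)) quadrant := by
  refine ContinuousOn.mul (by fun_prop)
    ((continuousOn_vortexDensity hα).comp (by fun_prop) fun y hy => ?_)
  have : (0 : ℝ) ≤ y.1 := hy.1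
  exact (by linarith : (0 : ℝ) < y.1 + τ)

lemma hasFDerivAt_scaled {α a τ t ρ : ℝ} (hα : 0 < α) (ht : 0 < t + τ) :
    HasFDerivAt (fun y : ℝ × ℝ => (y.2 - a) * vortexDensity α (y.1 + τ))
      (slopeCLM (-(vortexDensity α (t + τ) ^ α * ((ρ - a) * vortexDensity α (t + τ))),
        vortexDensity α (t + τ))) (t, ρ) := by
  have h1 : HasFDerivAt (fun y : ℝ × ℝ => y.2 - a) (ContinuousLinearMap.snd ℝ ℝ ℝ) (t, ρ) :=
    hasFDerivAt_snd.sub_const a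
  have h2 : HasFDerivAt (fun y : ℝ × ℝ => y.1 + τ) (ContinuousLinearMap.fst ℝ ℝ ℝ) (t, ρ) :=
    hasFDerivAt_fst.add_const τ
  have h3 := (hasDerivAt_vortexDensity hα ht).comp_hasFDerivAt (t, ρ) h2
  refine (h1.mul h3).congr_fderiv ?_
  ext
  · simp [slopeCLM]
    ring
  · simp [slopeCLM]

/-- A density bounded by that of the vortex at age `τ` produces no more mass than that vortex. -/
lemma IsViscositySubsolution.le_vortex {α : ℝ} (hα : 0 < α) {m₀ : ℝ → ℝ} {m : ℝ × ℝ → ℝ}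
    (hm : IsViscositySubsolution α m₀ m) {C : ℝ} (hC : ∀ x ∈ quadrant, m x ≤ C) {τ : ℝ}
    (hτ : 0 < τ) (hinit : ∀ ρ, 0 < ρ → m₀ ρ ≤ ρ * vortexDensity α τ) {x : ℝ × ℝ}
    (hx : x ∈ quadrant) : m x ≤ x.2 * vortexDensity α (x.1 + τ) := by
  have hκ : ∀ t : ℝ, 0 ≤ t → 0 < vortexDensity α (t + τ) := fun t ht =>
    vortexDensity_pos hα (by linarith)
  have h := hm.le_barrier (ψ := fun y => (y.2 - 0) * vortexDensity α (y.1 + τ)) hC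
    (continuousOn_scaled hα hτ)
    (fun y hy => mul_nonneg (by simpa using hy.2) (hκ y.1 hy.1).le)
    (fun ρ hρ => by simpa using hinit ρ hρ)
    (fun t ht ρ hρ hlt => ⟨_, hasFDerivAt_scaled hα (by linarith), fun q hq => ?_⟩) hx
  · simpa using h
  · have hk := hκ t ht.le
    dsimp only at hq hlt ⊢
    have h1 : vortexDensity α (t + τ) ^ α ≤ max q 0 ^ α :=
      Real.rpow_le_rpow hk.le (hq.trans (le_max_left _ _)) hα.le
    have h2 : 0 ≤ (ρ - 0) * vortexDensity α (t + τ) := by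
      rw [sub_zero]
      positivity
    have h3 := mul_le_mul h1 hlt.le h2 (by positivity)
    linarith

/-- A smooth approximation from below of `min z M = (z + M - |z - M|) / 2`, in which `|x|` is
replaced by `√(x² + η²)`. -/
noncomputable def smoothMin (η M z : ℝ) : ℝ := (z + M - √((z - M) ^ 2 + η ^ 2)) / 2

lemma smoothMin_le_min (η M z : ℝ) : smoothMin η M z ≤ min z M := by
  have h : |z - M| ≤ √((z - M) ^ 2 + η ^ 2) := Real.abs_le_sqrt (by nlinarith [sq_nonneg η])
  rw [smoothMin, le_min_iff]
  constructor <;> linarith [neg_le_of_abs_le h, le_of_abs_le h]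

lemma smoothMin_zero (M z : ℝ) : smoothMin 0 M z = min z M := by
  rw [smoothMin, zero_pow two_ne_zero, add_zero, Real.sqrt_sq_eq_abs]
  rcases le_total z M with h | h
  · rw [min_eq_left h, abs_of_nonpos (by linarith)]
    ring
  · rw [min_eq_right h, abs_of_nonneg (by linarith)]
    ring

lemma hasDerivAt_smoothMin {η : ℝ} (hη : 0 < η) (M z : ℝ) :
    ∃ d, 0 ≤ d ∧ d ≤ 1 ∧ HasDerivAt (smoothMin η M) d z := by
  have hpos : 0 < (z - M) ^ 2 + η ^ 2 := by positivity
  have h : |z - M| ≤ √((z - M) ^ 2 + η ^ 2) := Real.abs_le_sqrt (by nlinarith [sq_nonneg η])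
  set r := √((z - M) ^ 2 + η ^ 2) with hr
  have hr0 : 0 < r := Real.sqrt_pos.2 hpos
  have h1 := (((hasDerivAt_id z).sub_const M).pow 2).add_const (η ^ 2)
  have h2 := ((((hasDerivAt_id z).add_const M).sub (h1.sqrt hpos.ne')).div_const 2)
  refine ⟨(1 - (z - M) / r) / 2, ?_, ?_, h2.congr_deriv ?_⟩
  · have : (z - M) / r ≤ 1 := (div_le_one hr0).2 (le_of_abs_le h)
    linarith
  · have : -1 ≤ (z - M) / r := by
      rw [le_div_iff₀ hr0]
      linarith [neg_le_of_abs_le h]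
    linarith
  · simp only [id, Pi.pow_apply, ← hr]
    field_simp
    push_cast
    ring

/-- The smoothed vortex of mass `M` with origin shifted to `a` is a classical subsolution where it
is positive, hence stays below every nonnegative viscosity supersolution that starts with full mass
`M` beyond `a`. With `z = (ρ - a) κ` and `d = Φ'(z)`, the inequality to be checked is
`d^α Φ(z) ≤ d z`, which holds since `d ∈ [0,1]`, `α ≥ 1` and `Φ(z) ≤ z`. -/
lemma IsViscositySupersolution.smoothed_vortex_le {α : ℝ} (hα : 1 ≤ α) {m₀ : ℝ → ℝ}
    {m : ℝ × ℝ → ℝ} (hm : IsViscositySupersolution α m₀ m) (hm0 : ∀ x ∈ quadrant, 0 ≤ m x)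
    {M a η τ : ℝ} (ha : 0 ≤ a) (hη : 0 < η) (hτ : 0 < τ) (hm₀ : ∀ ρ, 0 < ρ → 0 ≤ m₀ ρ)
    (hinit : ∀ ρ, 0 < ρ → a ≤ ρ → M ≤ m₀ ρ) {x : ℝ × ℝ} (hx : x ∈ quadrant) :
    smoothMin η M ((x.2 - a) * vortexDensity α (x.1 + τ)) ≤ m x := by
  have hα0 : 0 < α := by linarith
  have hneg : ∀ t ρ : ℝ, 0 ≤ t → ρ ≤ a →
      smoothMin η M ((ρ - a) * vortexDensity α (t + τ)) ≤ 0 := fun t ρ ht hρ =>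
    ((smoothMin_le_min _ _ _).trans (min_le_left _ _)).trans
      (mul_nonpos_of_nonpos_of_nonneg (by linarith) (vortexDensity_pos hα0 (by linarith)).le)
  have hΦc : Continuous (smoothMin η M) := by
    unfold smoothMin
    fun_prop
  refine hm.barrier_le (ψ := fun y => smoothMin η M ((y.2 - a) * vortexDensity α (y.1 + τ)))
    (C := 0) (by simpa using hm0) (hΦc.comp_continuousOn (continuousOn_scaled hα0 hτ)) (K := M)
    (fun y _ => (smoothMin_le_min _ _ _).trans (min_le_right _ _)) (fun ρ hρ => ?_)
    (fun t ht => hneg t 0 ht ha) (fun t ht ρ hρ hlt => ?_) hx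
  · rcases le_total ρ a with h | h
    · exact (hneg 0 ρ le_rfl h).trans (hm₀ ρ hρ)
    · exact ((smoothMin_le_min _ _ _).trans (min_le_right _ _)).trans (hinit ρ hρ h)
  · set κ := vortexDensity α (t + τ) with hκ
    have hκ0 : 0 < κ := vortexDensity_pos hα0 (by linarith)
    set z := (ρ - a) * κ with hz
    obtain ⟨d, hd0, hd1, hd⟩ := hasDerivAt_smoothMin hη M z
    refine ⟨(-(d * (κ ^ α * z)), d * κ), ?_, fun q hq => ?_⟩
    · have h := hd.comp_hasFDerivAt (t, ρ) (hasFDerivAt_scaled (a := a) hα0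
        (by linarith : 0 < t + τ))
      refine h.congr_fderiv ?_
      ext <;> simp [slopeCLM, ← hκ, ← hz]
    · dsimp only at hq hlt ⊢
      have h0 : 0 ≤ m (t, ρ) := hm0 _ ⟨ht.le, hρ.le⟩
      have hmz : m (t, ρ) ≤ z :=
        hlt.le.trans ((smoothMin_le_min _ _ _).trans (min_le_left _ _))
      have h1 : max q 0 ^ α ≤ d * κ ^ α := calc
        max q 0 ^ α ≤ (d * κ) ^ α :=
          Real.rpow_le_rpow (le_max_right _ _) (max_le hq (by positivity)) hα0.le
        _ = d ^ α * κ ^ α := Real.mul_rpow hd0 hκ0.le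
        _ ≤ d * κ ^ α := by
          gcongr
          simpa using Real.rpow_le_rpow_of_exponent_ge_of_imp hd0 hd1 hα (by intros; linarith)
      have h2 := mul_le_mul h1 hmz h0 (by positivity)
      linarith

/-- The vortex of mass `M` with origin shifted to `a` bounds the solution from below. -/
lemma IsViscositySupersolution.vortex_le {α : ℝ} (hα : 1 ≤ α) {m₀ : ℝ → ℝ}
    {m : ℝ × ℝ → ℝ} (hm : IsViscositySupersolution α m₀ m) (hm0 : ∀ x ∈ quadrant, 0 ≤ m x)
    {M a : ℝ} (ha : 0 ≤ a) (hm₀ : ∀ ρ, 0 < ρ → 0 ≤ m₀ ρ)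
    (hinit : ∀ ρ, 0 < ρ → a ≤ ρ → M ≤ m₀ ρ) {t ρ : ℝ} (ht : 0 < t) (hρ : 0 ≤ ρ) :
    min ((ρ - a) * vortexDensity α t) M ≤ m (t, ρ) := by
  have hα0 : 0 < α := by linarith
  -- The smoothing parameter and the age at time zero are sent to zero together.
  have hlim : Tendsto (fun s : ℝ => smoothMin s M ((ρ - a) * vortexDensity α (t + s))) (𝓝[>] 0)
      (𝓝 (min ((ρ - a) * vortexDensity α t) M)) := by
    have hc : ContinuousAt (fun s : ℝ => vortexDensity α (t + s)) 0 := by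
      refine ContinuousAt.comp (f := fun s : ℝ => t + s) (g := vortexDensity α) ?_
        (by fun_prop)
      simpa using (hasDerivAt_vortexDensity hα0 ht).continuousAt
    have hc' : ContinuousAt
        (fun s : ℝ => smoothMin s M ((ρ - a) * vortexDensity α (t + s))) 0 := by
      unfold smoothMin
      fun_prop
    have h := hc'.tendsto
    rw [smoothMin_zero, add_zero] at h
    exact h.mono_left nhdsWithin_le_nhds
  exact le_of_tendsto hlim (eventually_mem_nhdsWithin.mono fun s hs =>
    hm.smoothed_vortex_le hα hm0 ha hs hs hm₀ hinit (x := (t, ρ)) ⟨ht.le, hρ⟩)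

lemma exists_vortexDensity_eq {α L : ℝ} (hα : 0 < α) (hL : 0 < L) :
    ∃ τ > 0, vortexDensity α τ = L := by
  refine ⟨L ^ (-α) / α, by positivity, ?_⟩
  rw [vortexDensity, mul_div_cancel₀ _ hα.ne', ← Real.rpow_mul hL.le]
  have : -α * -(1 / α) = 1 := by field_simp
  rw [this, Real.rpow_one]

/-! ### The initial mass function -/

/-- An essentially bounded density with bounded support is integrable. -/
lemma integrableOn_of_bounded_support {u₀ : ℝ → ℝ}
    (hbdd : MemLp u₀ ⊤ (volume.restrict (Ioi 0))) {R : ℝ} (hR : 0 ≤ R)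
    (hsupp : ∀ᵐ ρ ∂(volume.restrict (Ioi (0 : ℝ))), R < ρ → u₀ ρ = 0) :
    IntegrableOn u₀ (Ioi 0) := by
  have h1 : IntegrableOn u₀ (Ioc 0 R) :=
    (hbdd.mono_measure (Measure.restrict_mono Ioc_subset_Ioi_self le_rfl)).integrable le_top
  have h2 : IntegrableOn u₀ (Ioi R) := by
    have h : ∀ᵐ ρ ∂(volume.restrict (Ioi R)), (0 : ℝ) = u₀ ρ := by
      filter_upwards [ae_mono (Measure.restrict_mono (Ioi_subset_Ioi hR) le_rfl) hsupp,
        ae_restrict_mem measurableSet_Ioi] with ρ h hρ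
      exact (h hρ).symm
    exact (integrable_zero ℝ ℝ _).congr h
  rw [← Ioc_union_Ioi_eq_Ioi hR]
  exact h1.union h2

lemma initialMass_eq_setIntegral {u₀ : ℝ → ℝ} {ρ : ℝ} (hρ : 0 ≤ ρ) :
    initialMass u₀ ρ = ∫ s in Ioc 0 ρ, u₀ s :=
  intervalIntegral.integral_of_le hρ

lemma initialMass_mono {u₀ : ℝ → ℝ} (hint : IntegrableOn u₀ (Ioi 0))
    (hnonneg : ∀ᵐ ρ ∂(volume.restrict (Ioi (0 : ℝ))), 0 ≤ u₀ ρ) {ρ σ : ℝ} (hρ : 0 ≤ ρ)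
    (hρσ : ρ ≤ σ) : initialMass u₀ ρ ≤ initialMass u₀ σ := by
  rw [initialMass_eq_setIntegral hρ, initialMass_eq_setIntegral (hρ.trans hρσ)]
  exact setIntegral_mono_set (hint.mono_set Ioc_subset_Ioi_self)
    (ae_mono (Measure.restrict_mono Ioc_subset_Ioi_self le_rfl) hnonneg)
    (Ioc_subset_Ioc_right hρσ).eventuallyLE

lemma initialMass_le_integral {u₀ : ℝ → ℝ} (hint : IntegrableOn u₀ (Ioi 0))
    (hnonneg : ∀ᵐ ρ ∂(volume.restrict (Ioi (0 : ℝ))), 0 ≤ u₀ ρ) {ρ : ℝ} (hρ : 0 ≤ ρ) :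
    initialMass u₀ ρ ≤ ∫ s in Ioi 0, u₀ s := by
  rw [initialMass_eq_setIntegral hρ]
  exact setIntegral_mono_set hint hnonneg Ioc_subset_Ioi_self.eventuallyLE

lemma initialMass_eq_integral {u₀ : ℝ → ℝ} {R : ℝ} (hR : 0 ≤ R)
    (hsupp : ∀ᵐ ρ ∂(volume.restrict (Ioi (0 : ℝ))), R < ρ → u₀ ρ = 0) :
    initialMass u₀ R = ∫ s in Ioi 0, u₀ s := by
  rw [initialMass_eq_setIntegral hR]
  refine (setIntegral_eq_of_subset_of_ae_sdiff_eq_zero measurableSet_Ioi.nullMeasurableSet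
    Ioc_subset_Ioi_self ?_).symm
  filter_upwards [(ae_restrict_iff' measurableSet_Ioi).1 hsupp] with ρ h hρ
  exact h hρ.1 (not_le.1 fun hle => hρ.2 ⟨hρ.1, hle⟩)

lemma exists_initialMass_le_mul {u₀ : ℝ → ℝ} (hbdd : MemLp u₀ ⊤ (volume.restrict (Ioi 0))) :
    ∃ L > 0, ∀ ρ, 0 ≤ ρ → initialMass u₀ ρ ≤ ρ * L := by
  set N := (eLpNormEssSup u₀ (volume.restrict (Ioi 0))).toReal with hN
  have hfin : eLpNormEssSup u₀ (volume.restrict (Ioi 0)) ≠ ⊤ := by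
    simpa using hbdd.eLpNorm_ne_top
  have hae : ∀ᵐ ρ ∂(volume.restrict (Ioi (0 : ℝ))), ‖u₀ ρ‖ ≤ N := by
    filter_upwards [ae_le_eLpNormEssSup (f := u₀) (μ := volume.restrict (Ioi 0))] with ρ h
    have := ENNReal.toReal_mono hfin h
    simpa using this
  refine ⟨N + 1, by positivity, fun ρ hρ => ?_⟩
  have h := intervalIntegral.norm_integral_le_of_norm_le_const_ae (a := 0) (b := ρ) (f := u₀)
    (C := N) (by
      filter_upwards [(ae_restrict_iff' measurableSet_Ioi).1 hae] with s hs hmem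
      rw [uIoc_of_le hρ] at hmem
      exact hs hmem.1)
  have h1 : initialMass u₀ ρ ≤ N * |ρ - 0| := (Real.le_norm_self _).trans h
  rw [sub_zero, abs_of_nonneg hρ] at h1
  linarith

/-! ### The support edge and the profile -/

/-- By continuity of `m(t, ·)` the infimum defining the edge of the support is attained. -/
lemma supportEdge_mem_fullMassSet {M : ℝ} {m : ℝ × ℝ → ℝ} (hm : ContinuousOn m quadrant) {t : ℝ}
    (ht : 0 ≤ t) (hne : (fullMassSet M m t).Nonempty) :
    supportEdge M m t ∈ fullMassSet M m t := by
  have hc : ContinuousOn (fun ρ : ℝ => m (t, ρ)) (Ici 0) :=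
    hm.comp (by fun_prop) fun s hs => ⟨ht, hs⟩
  have hcl : IsClosed (fullMassSet M m t) :=
    hc.preimage_isClosed_of_isClosed isClosed_Ici (isClosed_singleton (x := M))
  exact hcl.csInf_mem hne ⟨0, fun ρ hρ => hρ.1⟩

/-- The two-sided estimate that carries the theorem: the solution lies between the vortex with
origin shifted to `S(0)` and the centred vortex. -/
lemma IsViscositySolution.between_vortices {α : ℝ} (hα : 1 ≤ α) {u₀ : ℝ → ℝ}
    (hbdd : MemLp u₀ ⊤ (volume.restrict (Ioi 0)))
    (hnonneg : ∀ᵐ ρ ∂(volume.restrict (Ioi (0 : ℝ))), 0 ≤ u₀ ρ)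
    (hsupp : ∃ R : ℝ, ∀ᵐ ρ ∂(volume.restrict (Ioi (0 : ℝ))), R < ρ → u₀ ρ = 0)
    {M : ℝ} (hM : M = ∫ ρ in Ioi (0 : ℝ), |u₀ ρ|) (hMpos : 0 < M)
    {m : ℝ × ℝ → ℝ} (hBUC : IsBUC m) (hm : IsViscositySolution α (initialMass u₀) m) :
    (fullMassSet M m 0).Nonempty ∧ ∀ t > 0, ∀ ρ ≥ 0,
      min ((ρ - supportEdge M m 0) * vortexDensity α t) M ≤ m (t, ρ) ∧
      m (t, ρ) ≤ min (ρ * vortexDensity α t) M := by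
  have hα0 : 0 < α := by linarith
  obtain ⟨hsub, hsup⟩ := hm
  obtain ⟨-, C, hC⟩ := hBUC
  obtain ⟨R, hR⟩ : ∃ R : ℝ, 0 < R ∧
      ∀ᵐ ρ ∂(volume.restrict (Ioi (0 : ℝ))), R < ρ → u₀ ρ = 0 := by
    obtain ⟨R, hR⟩ := hsupp
    refine ⟨max R 1, by positivity, hR.mono fun ρ h hρ => h ((le_max_left _ _).trans_lt hρ)⟩
  obtain ⟨hR0, hR⟩ := hR
  have hint := integrableOn_of_bounded_support hbdd hR0.le hR
  have hM' : M = ∫ ρ in Ioi (0 : ℝ), u₀ ρ := by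
    rw [hM]
    exact integral_congr_ae (hnonneg.mono fun ρ h => abs_of_nonneg h)
  have hm00 : initialMass u₀ 0 = 0 := by simp [initialMass]
  have hcorner : m (0, 0) = initialMass u₀ 0 := by
    rw [hm00]
    exact le_antisymm (boundary_nonpos hsub le_rfl) (boundary_nonneg hsup le_rfl)
  have hinit : ∀ ρ, 0 ≤ ρ → m (0, ρ) = initialMass u₀ ρ := by
    intro ρ hρ
    rcases hρ.eq_or_lt with rfl | hρ
    · exact hcorner
    · exact le_antisymm (hsub.initial ρ hρ) (hsup.initial ρ hρ)
  have hne : (fullMassSet M m 0).Nonempty :=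
    ⟨R, hR0.le, by rw [hinit R hR0.le, hM', initialMass_eq_integral hR0.le hR]⟩
  have hS := supportEdge_mem_fullMassSet hsub.continuousOn le_rfl hne
  have hm₀ : ∀ ρ, 0 < ρ → 0 ≤ initialMass u₀ ρ := fun ρ hρ => by
    have := initialMass_mono hint hnonneg le_rfl hρ.le
    rwa [hm00] at this
  have hm0 : ∀ x ∈ quadrant, 0 ≤ m x := fun x hx =>
    hsup.nonneg hα0.ne' (fun y hy => neg_le_of_abs_le (hC y hy)) hm₀ hx
  have hCu : ∀ x ∈ quadrant, m x ≤ C := fun y hy => le_of_abs_le (hC y hy)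
  obtain ⟨L, hL, hmL⟩ := exists_initialMass_le_mul hbdd
  obtain ⟨τ, hτ, hτL⟩ := exists_vortexDensity_eq hα0 hL
  refine ⟨hne, fun t ht ρ hρ => ⟨?_, le_min ?_ ?_⟩⟩
  · refine hsup.vortex_le hα hm0 hS.1 hm₀ (fun σ hσ hSσ => ?_) ht hρ
    calc M = initialMass u₀ (supportEdge M m 0) := by rw [← hinit _ hS.1, hS.2]
      _ ≤ initialMass u₀ σ := initialMass_mono hint hnonneg hS.1 hSσ
  · have h := hsub.le_vortex hα0 hCu hτ (fun σ hσ => by rw [hτL]; exact hmL σ hσ.le)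
      (x := (t, ρ)) ⟨ht.le, hρ⟩
    exact h.trans (mul_le_mul_of_nonneg_left
      (vortexDensity_anti hα0 ht (by linarith)) hρ)
  · exact hsub.le_const hCu hMpos.le
      (fun σ hσ => (initialMass_le_integral hint hnonneg hσ.le).trans hM'.ge) ⟨ht.le, hρ⟩

lemma vortexProfile_eq_min (y : ℝ) : vortexProfile y = min y 1 := by
  unfold vortexProfile
  split_ifs with h
  · exact (min_eq_left h).symm
  · exact (min_eq_right (not_le.1 h).le).symm

lemma tendsto_vortexDensity_atTop {α : ℝ} (hα : 0 < α) :
    Tendsto (vortexDensity α) atTop (𝓝 0) :=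
  (tendsto_rpow_neg_atTop (by positivity)).comp (tendsto_id.const_mul_atTop hα)

/-- In rescaled volume, the lower vortex bound controls the relative deviation from the profile:
`min (M y - s) M ≥ M min y 1 - s` for `s ≥ 0`. -/
lemma abs_div_vortexProfile_sub_one_le {M s ε y v : ℝ} (hM : 0 < M) (hs : 0 ≤ s) (hε : 0 < ε)
    (hy : ε ≤ y) (hlow : min (M * y - s) M ≤ v) (hup : v ≤ min (M * y) M) :
    |v / (M * vortexProfile y) - 1| ≤ s / (M * min ε 1) := by
  have hG : 0 < min y 1 := lt_min (hε.trans_le hy) one_pos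
  have hMG : M * min y 1 = min (M * y) M := by
    rw [mul_min_of_nonneg _ _ hM.le, mul_one]
  have hlow' : M * min y 1 - s ≤ v := by
    refine le_trans ?_ hlow
    rw [hMG]
    exact le_min (by linarith [min_le_left (M * y) M]) (by linarith [min_le_right (M * y) M])
  have hMG0 : 0 < M * min y 1 := mul_pos hM hG
  rw [vortexProfile_eq_min, div_sub_one hMG0.ne', abs_div, abs_of_pos hMG0,
    abs_of_nonpos (by linarith)]
  have hε1 : 0 < min ε 1 := lt_min hε one_pos
  gcongr
  linarith

end MassHJ

theorem mainTheorem6 (α : ℝ) (hα : 1 ≤ α) (u₀ : ℝ → ℝ)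
    (hbdd : MemLp u₀ ⊤ (volume.restrict (Ioi 0)))
    (hnonneg : ∀ᵐ ρ ∂(volume.restrict (Ioi (0 : ℝ))), 0 ≤ u₀ ρ)
    (hsupp : ∃ R : ℝ, ∀ᵐ ρ ∂(volume.restrict (Ioi (0 : ℝ))), R < ρ → u₀ ρ = 0)
    (M : ℝ) (hM : M = ∫ ρ in Ioi (0 : ℝ), |u₀ ρ|) (hMpos : 0 < M)
    (m : ℝ × ℝ → ℝ) (hBUC : MassHJ.IsBUC m)
    (hm : MassHJ.IsViscositySolution α (MassHJ.initialMass u₀) m) :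
    (∀ t : ℝ, 0 ≤ t → (MassHJ.fullMassSet M m t).Nonempty) ∧
    (∀ t : ℝ, 0 < t →
      0 ≤ MassHJ.supportEdge M m t / (M * (α * t) ^ (1 / α)) - 1 ∧
      MassHJ.supportEdge M m t / (M * (α * t) ^ (1 / α)) - 1
        ≤ MassHJ.supportEdge M m 0 / M * (α * t) ^ (-(1 / α))) ∧
    Asymptotics.IsEquivalent atTop (fun t : ℝ => MassHJ.supportEdge M m t)
      (fun t : ℝ => M * (α * t) ^ (1 / α)) ∧
    (∀ ε : ℝ, 0 < ε →
      TendstoUniformlyOn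
        (fun (t y : ℝ) => m (t, M * (α * t) ^ (1 / α) * y) / (M * MassHJ.vortexProfile y))
        (fun _ => 1) atTop (Ici ε)) := by
  have hα0 : 0 < α := by linarith
  obtain ⟨hne, hb⟩ := hm.between_vortices hα hbdd hnonneg hsupp hM hMpos hBUC
  have hS0 := (MassHJ.supportEdge_mem_fullMassSet hm.1.continuousOn le_rfl hne).1
  set S₀ := MassHJ.supportEdge M m 0
  have hr : ∀ t : ℝ, 0 < t → 0 < (α * t) ^ (1 / α) := fun t ht =>
    Real.rpow_pos_of_pos (mul_pos hα0 ht) _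
  -- The edge `S₀ + M (αt)^{1/α}` of the shifted vortex already carries the full mass.
  have hmem : ∀ t : ℝ, 0 < t → S₀ + M * (α * t) ^ (1 / α) ∈ MassHJ.fullMassSet M m t := by
    intro t ht
    have hr0 := hr t ht
    have hpos : 0 ≤ S₀ + M * (α * t) ^ (1 / α) := by positivity
    obtain ⟨h1, h2⟩ := hb t ht _ hpos
    refine ⟨hpos, le_antisymm (h2.trans (min_le_right _ _)) ?_⟩
    rwa [add_sub_cancel_left, mul_assoc, MassHJ.vortexDensity_mul_radius hα0 ht, mul_one,
      min_self] at h1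
  have hedge : ∀ t : ℝ, 0 < t →
      0 ≤ MassHJ.supportEdge M m t / (M * (α * t) ^ (1 / α)) - 1 ∧
      MassHJ.supportEdge M m t / (M * (α * t) ^ (1 / α)) - 1
        ≤ S₀ / M * (α * t) ^ (-(1 / α)) := by
    intro t ht
    have hr0 := hr t ht
    have hMr := mul_pos hMpos hr0
    have hlow : M * (α * t) ^ (1 / α) ≤ MassHJ.supportEdge M m t := by
      refine le_csInf ⟨_, hmem t ht⟩ fun ρ hρ => ?_
      have h1 : M ≤ ρ * MassHJ.vortexDensity α t :=
        hρ.2.symm.le.trans ((hb t ht ρ hρ.1).2.trans (min_le_left _ _))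
      calc M * (α * t) ^ (1 / α)
          ≤ ρ * MassHJ.vortexDensity α t * (α * t) ^ (1 / α) := by gcongr
        _ = ρ * ((α * t) ^ (1 / α) * MassHJ.vortexDensity α t) := by ring
        _ = ρ := by rw [MassHJ.vortexDensity_mul_radius hα0 ht, mul_one]
    have hup : MassHJ.supportEdge M m t ≤ S₀ + M * (α * t) ^ (1 / α) :=
      csInf_le ⟨0, fun ρ hρ => hρ.1⟩ (hmem t ht)
    rw [Real.rpow_neg (mul_pos hα0 ht).le]
    constructor
    · rw [sub_nonneg, one_le_div hMr]
      exact hlow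
    · rw [sub_le_iff_le_add, div_le_iff₀ hMr]
      refine hup.trans_eq ?_
      field_simp
  refine ⟨fun t ht => ?_, hedge, ?_, fun ε hε => ?_⟩
  · rcases ht.eq_or_lt with rfl | ht
    · exact hne
    · exact ⟨_, hmem t ht⟩
  · rw [Asymptotics.isEquivalent_iff_tendsto_one (by
      filter_upwards [eventually_gt_atTop 0] with t ht
      exact (mul_pos hMpos (hr t ht)).ne')]
    have hlim := ((MassHJ.tendsto_vortexDensity_atTop hα0).const_mul (S₀ / M)).const_add 1
    rw [mul_zero, add_zero] at hlim
    refine tendsto_of_tendsto_of_tendsto_of_le_of_le' tendsto_const_nhds hlim ?_ ?_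
    · filter_upwards [eventually_gt_atTop 0] with t ht
      exact sub_nonneg.1 (hedge t ht).1
    · filter_upwards [eventually_gt_atTop 0] with t ht
      exact sub_le_iff_le_add'.1 (hedge t ht).2
  · rw [Metric.tendstoUniformlyOn_iff]
    intro θ hθ
    have hlim : Tendsto (fun t : ℝ => S₀ * MassHJ.vortexDensity α t / (M * min ε 1)) atTop
        (𝓝 0) := by
      simpa using ((MassHJ.tendsto_vortexDensity_atTop hα0).const_mul S₀).div_const (M * min ε 1)
    filter_upwards [eventually_gt_atTop 0, hlim.eventually_lt_const hθ] with t ht hlt y hy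
    have hy' : ε ≤ y := hy
    have hr0 := hr t ht
    have hy0 : 0 < y := hε.trans_le hy'
    have hscale : M * (α * t) ^ (1 / α) * y * MassHJ.vortexDensity α t = M * y := by
      linear_combination M * y * MassHJ.vortexDensity_mul_radius hα0 ht
    obtain ⟨h1, h2⟩ := hb t ht (M * (α * t) ^ (1 / α) * y) (by positivity)
    rw [sub_mul, hscale] at h1
    rw [hscale] at h2
    rw [dist_comm, Real.dist_eq]
    exact (MassHJ.abs_div_vortexProfile_sub_one_le hMpos
      (mul_nonneg hS0 (MassHJ.vortexDensity_pos hα0 ht).le) hε hy' h1 h2).trans_lt hlt
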